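/- For $n\in\mathbb Z$ let $\lambda_n=in(n^4+n^2-1)$, the eigenvalue of $A=\partial_x^5-\partial_x^3-\partial_x$ (with $2\pi$-periodic boundary conditions) for the eigenfunction $e^{inx}$, and let $\hat h_k=\frac1{2\pi}\int_0^{2\pi}h(x)e^{-ikx}\,dx$ for $h\in L^2(0,2\pi)$ (complex-valued functions). There exist constants $T>2\pi$, $b>0$, $C>0$ and functions $\zeta_m\in L^2(-\frac T2,\frac T2)$, $m\in\mathbb Z$, with $$\int_{-T/2}^{T/2}\zeta_m(t)e^{-\lambda_nt}\,dt=\delta_{mn}\quad(m,n\in\mathbb Z),\qquad \int_{-T/2}^{T/2}\Big|\sum_m c_m\zeta_m(t)\Big|^2dt\le C\sum_m|c_m|^2e^{bm^6}$$ for all finitely supported $(c_m)_{m\in\mathbb Z}\subset\mathbb C$, such that the following holds. Let $\beta\ge b$, let $f\in L^2(0,2\pi)$ satisfy $\hat f_k\ne0$ for all $k\in\mathbb Z$, and put $$\widetilde{\mathcal H}=\Big\{h\in L^2(0,2\pi):\ \|h\|_{\widetilde{\mathcal H}}^2:=\sum_{k\in\mathbb Z}\Big|\frac{\hat h_k}{\hat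 f_k}\Big|^2e^{\beta k^6}<\infty\Big\}.$$ Then for every $u_0\in\widetilde{\mathcal H}$, with Fourier coefficients $\hat u^0_m$, the series $$v(t)=-\sum_{m\in\mathbb Z}\frac{\hat u^0_m}{\hat f_m}\,e^{T\lambda_m/2}\,\zeta_m\!\left(t-\tfrac T2\right)$$ converges unconditionally in $L^2(0,T)$, its sum satisfies $\|v\|_{L^2(0,T)}\le C\|u_0\|_{\widetilde{\mathcal H}}$, and the problem $$\begin{cases}u_t-\partial_x^5u+\partial_x^3u+\partial_xu=f(x)v(t)&\text{in }(0,T)\times(0,2\pi),\\ \partial_x^ju(t,0)=\partial_x^ju(t,2\pi),\quad j=0,\dots,4,&t\in(0,T),\\ u(0,x)=u_0(x)&\text{in }(0,2\pi)\end{cases}$$ has a weak solution $u\in C([0,T];L^2(0,2\pi))$, and every such solution satisfies $u(T,\cdot)=0$. Here weak solution means that $u(0)=u_0$ and, for every smooth $2\pi$-periodic $\varphi:\mathbb R\to\mathbb C$ and every $t\in[0,T]$, $$\int_0^{2\pi}u(t)\varphi\,dx=\int_0^{2\pi}u_0\varphi\,dx+\int_0^t\Big(\int_0^{2\pi}u(s)\,(-\varphi^{(5)}+\varphi'''+\varphi')\,dx+v(s)\int_0^{2\pi}f\varphi\,dx\Big)ds.$$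 -/

import Mathlib

open MeasureTheory Set Filter Topology
open scoped ContDiff

namespace Kawahara

/-- The space `L²(0, 2π)` of complex-valued square integrable functions. -/
abbrev L2per : Type := Lp ℂ 2 (volume.restrict (Ioc (0 : ℝ) (2 * Real.pi)))

/-- The Fourier coefficient `ĥ_k = (1 / 2π) ∫₀^{2π} h(x) e^{-ikx} dx`. -/
noncomputable def fcoeff (h : L2per) (k : ℤ) : ℂ :=
  fourierCoeffOn Real.two_pi_pos (h : ℝ → ℂ) k

theorem fcoeff_eq (h : L2per) (k : ℤ) :
    fcoeff h k = 1 / (2 * Real.pi) *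
      ∫ x in (0 : ℝ)..(2 * Real.pi), h x * Complex.exp (-(Complex.I * k * x)) := by
  have hpi : (Real.pi : ℂ) ≠ 0 := by exact_mod_cast Real.pi_ne_zero
  rw [fcoeff, fourierCoeffOn_eq_integral, Complex.real_smul]
  simp only [sub_zero]
  push_cast
  congr 1
  refine intervalIntegral.integral_congr fun x _ => ?_
  simp only [smul_eq_mul]
  rw [mul_comm, fourier_coe_apply]
  congr 2
  push_cast
  field_simp
  ring

/-- The eigenvalue `λ_n = i n (n⁴ + n² - 1)` of `∂ₓ⁵ - ∂ₓ³ - ∂ₓ` for the eigenfunction `e^{inx}`. -/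
noncomputable def eig (n : ℤ) : ℂ := Complex.I * (n * (n ^ 4 + n ^ 2 - 1))

theorem eig_spec (n : ℤ) : eig n =
    (Complex.I * n) ^ 5 - (Complex.I * n) ^ 3 - Complex.I * n := by
  have h2 : Complex.I ^ 2 = -1 := Complex.I_sq
  have h3 : Complex.I ^ 3 = -Complex.I := by rw [pow_succ, h2]; ring
  have h5 : Complex.I ^ 5 = Complex.I := by
    rw [show Complex.I ^ 5 = Complex.I ^ 2 * Complex.I ^ 3 by ring, h2, h3]; ring
  rw [eig, mul_pow, mul_pow, h3, h5]
  ring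

/-- Membership in the weighted space attached to the profile `f` and the parameter `β`. -/
def MemH (β : ℝ) (f h : L2per) : Prop :=
  Summable fun k : ℤ => ‖fcoeff h k / fcoeff f k‖ ^ 2 * Real.exp (β * (k : ℝ) ^ 6)

/-- The norm of the weighted space. -/
noncomputable def normH (β : ℝ) (f h : L2per) : ℝ :=
  Real.sqrt (∑' k : ℤ, ‖fcoeff h k / fcoeff f k‖ ^ 2 * Real.exp (β * (k : ℝ) ^ 6))

/-- `u ∈ C([0, T]; L²(0, 2π))` is a weak solution of
`u_t - u_{xxxxx} + u_{xxx} + u_x = f(x) v(t)` on `(0, T) × (0, 2π)`, with periodic boundary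
conditions `∂ₓʲ u(t, 0) = ∂ₓʲ u(t, 2π)`, `j = 0, …, 4`, and `u(0) = u₀`, where `v ∈ L²(0, T)`.
The equation and the boundary conditions are tested against smooth `2π`-periodic functions, which
need not vanish at `0` and `2π`. -/
structure IsWeakSolution (T : ℝ) (f u₀ : L2per) (v : ℝ → ℂ) (u : ℝ → L2per) : Prop where
  continuousOn : ContinuousOn u (Icc 0 T)
  initial : u 0 = u₀
  weak : ∀ φ : ℝ → ℂ, ContDiff ℝ ∞ φ → Function.Periodic φ (2 * Real.pi) → ∀ t ∈ Icc 0 T,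
    ∫ x in (0 : ℝ)..(2 * Real.pi), u t x * φ x =
      (∫ x in (0 : ℝ)..(2 * Real.pi), u₀ x * φ x) +
      ∫ s in (0 : ℝ)..t,
        ((∫ x in (0 : ℝ)..(2 * Real.pi),
            u s x * (-iteratedDeriv 5 φ x + iteratedDeriv 3 φ x + deriv φ x)) +
          v s * ∫ x in (0 : ℝ)..(2 * Real.pi), f x * φ x)

end Kawahara

namespace Kawahara

/-! The eigenvalues are `i` times pairwise distinct integers (`freq_injective`), so the functions
`e^{λ_n t}` are orthogonal on every interval whose length is a multiple of `2π`. With `T = 4π` the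
biorthogonal family is simply `ζ_m = (4π)⁻¹ e^{λ_m t}`, and Parseval gives the norm estimate with
room to spare.

After the shift by `T/2`, the control is `v = ∑ d_m e^{λ_m t}` with `d_m = -(4π)⁻¹ û⁰_m / f̂_m`. The
weight makes `d` absolutely summable (`summable_norm_and_tsum_le`), so `v` is continuous and bounded
and the series converges uniformly.

The equation decouples in Fourier space. Duhamel's formula for each coefficient builds a solution
(`exists_isWeakSolution`), and testing with `e^{-ikx}` shows that every weak solution has these
coefficients at time `T` (`IsWeakSolution.fcoeff_eq_duhamel`). There the forcing contributes `f̂_k ·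
4π d_k = -û⁰_k` (`integral_exp_mul_expSeries`), which cancels the initial value. -/

/-! ### Fourier coefficients and the trigonometric Hilbert basis -/

theorem memLp_of_continuous {g : ℝ → ℂ} (hg : Continuous g) (a b : ℝ) :
    MemLp g 2 (volume.restrict (Ioc a b)) := by
  obtain ⟨M, hM⟩ := isCompact_Icc.exists_bound_of_continuousOn (s := Icc a b) hg.continuousOn
  refine MemLp.of_bound hg.aestronglyMeasurable M ?_
  filter_upwards [ae_restrict_mem measurableSet_Ioc] with x hx
  exact hM x (Ioc_subset_Icc_self hx)

/-- The class of a continuous function in `L²(0, 2π)`. -/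
noncomputable def ofContinuous (g : ℝ → ℂ) (hg : Continuous g) : L2per :=
  (memLp_of_continuous hg 0 (2 * Real.pi)).toLp g

theorem coeFn_ofContinuous (g : ℝ → ℂ) (hg : Continuous g) :
    ofContinuous g hg =ᵐ[volume.restrict (Ioc (0 : ℝ) (2 * Real.pi))] g :=
  MemLp.coeFn_toLp _

theorem inner_ofContinuous (g : ℝ → ℂ) (hg : Continuous g) (h : L2per) :
    inner ℂ (ofContinuous g hg) h =
      ∫ x in (0 : ℝ)..(2 * Real.pi), h x * (starRingEnd ℂ) (g x) := by
  rw [L2.inner_def, intervalIntegral.integral_of_le Real.two_pi_pos.le]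
  refine integral_congr_ae ?_
  filter_upwards [coeFn_ofContinuous g hg] with x hx
  rw [hx, RCLike.inner_apply]

/-- The normalized exponential `e^{ikx} / √(2π)`. -/
noncomputable def normExp (k : ℤ) (x : ℝ) : ℂ :=
  ((Real.sqrt (2 * Real.pi))⁻¹ : ℝ) * Complex.exp (Complex.I * k * x)

theorem continuous_normExp (k : ℤ) : Continuous (normExp k) := by
  unfold normExp; fun_prop

theorem conj_normExp (k : ℤ) (x : ℝ) : (starRingEnd ℂ) (normExp k x) =
    ((Real.sqrt (2 * Real.pi))⁻¹ : ℝ) * Complex.exp (-(Complex.I * k * x)) := by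
  rw [normExp, map_mul, Complex.conj_ofReal, ← Complex.exp_conj]
  simp

theorem sqrt_two_pi_mul_self : Real.sqrt (2 * Real.pi) * Real.sqrt (2 * Real.pi) = 2 * Real.pi :=
  Real.mul_self_sqrt Real.two_pi_pos.le

theorem sqrt_two_pi_pos : 0 < Real.sqrt (2 * Real.pi) := Real.sqrt_pos.2 Real.two_pi_pos

theorem inner_normExp (k : ℤ) (h : L2per) :
    inner ℂ (ofContinuous (normExp k) (continuous_normExp k)) h =
      (Real.sqrt (2 * Real.pi) : ℂ) * fcoeff h k := by
  rw [inner_ofContinuous, fcoeff_eq]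
  simp_rw [conj_normExp]
  have : ∀ x : ℝ, h x * (((Real.sqrt (2 * Real.pi))⁻¹ : ℝ) * Complex.exp (-(Complex.I * k * x))) =
    ((Real.sqrt (2 * Real.pi))⁻¹ : ℝ) * (h x * Complex.exp (-(Complex.I * k * x))) :=
    fun x => by ring
  simp_rw [this]
  rw [intervalIntegral.integral_const_mul, ← mul_assoc]
  congr 1
  have h1 : (Real.sqrt (2 * Real.pi) : ℂ) ≠ 0 := by exact_mod_cast sqrt_two_pi_pos.ne'
  have h2 : (Real.sqrt (2 * Real.pi) : ℂ) * Real.sqrt (2 * Real.pi) = 2 * Real.pi := by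
    exact_mod_cast sqrt_two_pi_mul_self
  rw [← h2]
  push_cast
  field_simp

/-- The primitive is `2π`-periodic when `p ≠ 0`. One period (`N = 1`) serves the space variable, two
periods (`N = 2`) the time variable. -/
theorem integral_exp_int (p : ℤ) (a : ℝ) (N : ℕ) :
    ∫ t in a..(a + N * (2 * Real.pi)), Complex.exp (Complex.I * p * t) =
      if p = 0 then (N * (2 * Real.pi) : ℂ) else 0 := by
  split_ifs with hp
  · subst hp
    simp
  · have hc : Complex.I * (p : ℂ) ≠ 0 := mul_ne_zero Complex.I_ne_zero (by exact_mod_cast hp)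
    rw [integral_exp_mul_complex hc]
    have : Complex.I * p * ((a + N * (2 * Real.pi) : ℝ) : ℂ) =
        Complex.I * p * a + (p * N : ℤ) * (2 * Real.pi * Complex.I) := by
      push_cast; ring
    rw [this, Complex.exp_add, Complex.exp_int_mul_two_pi_mul_I]
    simp

theorem fcoeff_ofContinuous (g : ℝ → ℂ) (hg : Continuous g) (k : ℤ) :
    fcoeff (ofContinuous g hg) k = 1 / (2 * Real.pi) *
      ∫ x in (0 : ℝ)..(2 * Real.pi), g x * Complex.exp (-(Complex.I * k * x)) := by
  rw [fcoeff_eq, intervalIntegral.integral_of_le Real.two_pi_pos.le,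
    intervalIntegral.integral_of_le Real.two_pi_pos.le]
  congr 1
  refine integral_congr_ae ?_
  filter_upwards [coeFn_ofContinuous g hg] with x hx
  rw [hx]

theorem orthonormal_normExp :
    Orthonormal ℂ fun k => ofContinuous (normExp k) (continuous_normExp k) := by
  rw [orthonormal_iff_ite]
  intro i j
  rw [inner_normExp, fcoeff_ofContinuous]
  have : ∀ x : ℝ, normExp j x * Complex.exp (-(Complex.I * i * x)) =
      ((Real.sqrt (2 * Real.pi))⁻¹ : ℝ) * Complex.exp (Complex.I * (j - i : ℤ) * x) := fun x => by
    rw [normExp, mul_assoc, ← Complex.exp_add]; push_cast; ring_nf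
  simp_rw [this]
  have h0 := integral_exp_int (j - i) 0 1
  simp only [zero_add, Nat.cast_one, one_mul] at h0
  rw [intervalIntegral.integral_const_mul, h0]
  have h1 : (Real.sqrt (2 * Real.pi) : ℂ) ≠ 0 := by exact_mod_cast sqrt_two_pi_pos.ne'
  have h2 : (Real.pi : ℂ) ≠ 0 := by exact_mod_cast Real.pi_ne_zero
  by_cases hij : i = j
  · subst hij
    simp only [sub_self, if_true]
    push_cast
    field_simp
  · have : j - i ≠ 0 := sub_ne_zero.2 (Ne.symm hij)
    simp [hij, this]

theorem hasSum_sq_fcoeff (h : L2per) :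
    HasSum (fun k => ‖fcoeff h k‖ ^ 2) ((2 * Real.pi)⁻¹ * ‖h‖ ^ 2) := by
  have h1 := hasSum_sq_fourierCoeffOn Real.two_pi_pos (Lp.memLp h)
  rw [sub_zero, smul_eq_mul] at h1
  suffices ‖h‖ ^ 2 = ∫ x in (0 : ℝ)..(2 * Real.pi), ‖h x‖ ^ 2 by rw [this]; exact h1
  have h2 : ‖h‖ ^ 2 = RCLike.re (inner ℂ h h) := norm_sq_eq_re_inner h
  rw [h2, L2.inner_def, ← integral_re (L2.integrable_inner h h),
    intervalIntegral.integral_of_le Real.two_pi_pos.le]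
  simp only [← norm_sq_eq_re_inner]

theorem eq_zero_of_fcoeff_eq_zero {h : L2per} (hh : ∀ k, fcoeff h k = 0) : h = 0 := by
  have h1 := hasSum_sq_fcoeff h
  simp only [hh, norm_zero, ne_eq, OfNat.ofNat_ne_zero, not_false_eq_true, zero_pow] at h1
  have h2 := h1.unique hasSum_zero
  have h3 := Real.two_pi_pos
  simpa [Real.pi_ne_zero] using h2

/-- The trigonometric Hilbert basis of `L²(0, 2π)`. -/
noncomputable def expBasis : HilbertBasis ℤ ℂ L2per :=
  HilbertBasis.mkOfOrthogonalEqBot orthonormal_normExp (by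
    rw [Submodule.eq_bot_iff]
    intro h hh
    refine eq_zero_of_fcoeff_eq_zero fun k => ?_
    have h1 := (Submodule.mem_orthogonal _ _).1 hh _ (Submodule.subset_span ⟨k, rfl⟩)
    rw [inner_normExp] at h1
    exact (mul_eq_zero.1 h1).resolve_left (by exact_mod_cast sqrt_two_pi_pos.ne'))

theorem expBasis_apply (k : ℤ) :
    expBasis k = ofContinuous (normExp k) (continuous_normExp k) := by
  rw [expBasis, HilbertBasis.coe_mkOfOrthogonalEqBot]

theorem fcoeff_eq_inner (h : L2per) (k : ℤ) :
    fcoeff h k = (Real.sqrt (2 * Real.pi) : ℂ)⁻¹ * inner ℂ (expBasis k) h := by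
  have h1 : (Real.sqrt (2 * Real.pi) : ℂ) ≠ 0 := by exact_mod_cast sqrt_two_pi_pos.ne'
  rw [expBasis_apply, inner_normExp, inv_mul_cancel_left₀ h1]

theorem fcoeff_sub (g h : L2per) (k : ℤ) : fcoeff (g - h) k = fcoeff g k - fcoeff h k := by
  simp only [fcoeff_eq_inner, inner_sub_right, mul_sub]

theorem continuous_fcoeff (k : ℤ) : Continuous fun h => fcoeff h k := by
  simp only [fcoeff_eq_inner]
  fun_prop

theorem exists_fcoeff_eq {c : ℤ → ℂ} (hc : Summable fun k => ‖c k‖ ^ 2) :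
    ∃ h : L2per, ∀ k, fcoeff h k = c k := by
  have h1 : (Real.sqrt (2 * Real.pi) : ℂ) ≠ 0 := by exact_mod_cast sqrt_two_pi_pos.ne'
  have hm : Memℓp (fun k => (Real.sqrt (2 * Real.pi) : ℂ) * c k) 2 := by
    refine memℓp_gen ?_
    simp only [norm_mul, ENNReal.toReal_ofNat, Real.rpow_two, mul_pow]
    exact hc.mul_left _
  refine ⟨expBasis.repr.symm ⟨_, hm⟩, fun k => ?_⟩
  rw [fcoeff_eq_inner, ← HilbertBasis.repr_apply_apply, LinearIsometryEquiv.apply_symm_apply]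
  simp only [inv_mul_cancel_left₀ h1]

/-! ### Test functions and the adjoint operator -/

/-- The pairing of a test function with `e^{ikx}`. -/
noncomputable def pairExp (φ : ℝ → ℂ) (k : ℤ) : ℂ :=
  ∫ x in (0 : ℝ)..(2 * Real.pi), Complex.exp (Complex.I * k * x) * φ x

theorem integral_mul_eq_inner (h : L2per) {φ : ℝ → ℂ} (hφ : Continuous φ) :
    ∫ x in (0 : ℝ)..(2 * Real.pi), h x * φ x =
      inner ℂ (ofContinuous (fun x => (starRingEnd ℂ) (φ x)) (by fun_prop)) h := by
  rw [inner_ofContinuous]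
  simp

theorem pairExp_eq_inner {φ : ℝ → ℂ} (hφ : Continuous φ) (k : ℤ) :
    pairExp φ k = Real.sqrt (2 * Real.pi) *
      inner ℂ (ofContinuous (fun x => (starRingEnd ℂ) (φ x)) (by fun_prop)) (expBasis k) := by
  have h1 : (Real.sqrt (2 * Real.pi) : ℂ) ≠ 0 := by exact_mod_cast sqrt_two_pi_pos.ne'
  rw [← integral_mul_eq_inner _ hφ, pairExp, ← intervalIntegral.integral_const_mul,
    intervalIntegral.integral_of_le Real.two_pi_pos.le,
    intervalIntegral.integral_of_le Real.two_pi_pos.le, expBasis_apply]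
  refine integral_congr_ae ?_
  filter_upwards [coeFn_ofContinuous _ (continuous_normExp k)] with x hx
  rw [hx, normExp]
  push_cast
  field_simp

theorem hasSum_fcoeff_mul_pairExp (h : L2per) {φ : ℝ → ℂ} (hφ : Continuous φ) :
    HasSum (fun k => fcoeff h k * pairExp φ k) (∫ x in (0 : ℝ)..(2 * Real.pi), h x * φ x) := by
  have h1 : (Real.sqrt (2 * Real.pi) : ℂ) ≠ 0 := by exact_mod_cast sqrt_two_pi_pos.ne'
  rw [integral_mul_eq_inner _ hφ]
  refine (expBasis.hasSum_inner_mul_inner _ h).congr_fun fun k => ?_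
  rw [pairExp_eq_inner hφ, fcoeff_eq_inner]
  field_simp

theorem summable_sq_pairExp {φ : ℝ → ℂ} (hφ : Continuous φ) :
    Summable fun k => ‖pairExp φ k‖ ^ 2 := by
  have := (expBasis.orthonormal.inner_products_summable
    (ofContinuous (fun x => (starRingEnd ℂ) (φ x)) (by fun_prop))).mul_left
      (‖(Real.sqrt (2 * Real.pi) : ℂ)‖ ^ 2)
  refine this.congr fun k => ?_
  rw [pairExp_eq_inner hφ, norm_mul, mul_pow, norm_inner_symm]

/-- Integration by parts; the boundary terms cancel because both factors are `2π`-periodic. -/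
theorem pairExp_deriv {φ : ℝ → ℂ} (hφ : ContDiff ℝ ∞ φ) (hp : Function.Periodic φ (2 * Real.pi))
    (k : ℤ) : pairExp (deriv φ) k = -(Complex.I * k) * pairExp φ k := by
  have hd : ∀ x : ℝ, HasDerivAt (fun x : ℝ => Complex.exp (Complex.I * k * x))
      (Complex.I * k * Complex.exp (Complex.I * k * x)) x := fun x => by
    have := ((Complex.ofRealCLM.hasDerivAt (x := x)).const_mul (Complex.I * k)).cexp
    simpa [mul_comm] using this
  have hφ' : ∀ x : ℝ, HasDerivAt φ (deriv φ x) x := fun x =>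
    (hφ.differentiable (by simp) x).hasDerivAt
  have hc : Continuous (deriv φ) := hφ.continuous_deriv (by simp)
  have := intervalIntegral.integral_mul_deriv_eq_deriv_mul (a := 0) (b := 2 * Real.pi)
    (fun x _ => hd x) (fun x _ => hφ' x)
    (Continuous.intervalIntegrable (by fun_prop) _ _) (hc.intervalIntegrable _ _)
  rw [pairExp, this, pairExp]
  have h1 : φ (2 * Real.pi) = φ 0 := by simpa using hp 0
  have h2 : Complex.exp (Complex.I * k * (2 * Real.pi : ℝ)) = 1 := by
    rw [← Complex.exp_int_mul_two_pi_mul_I k]; push_cast; ring_nf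
  simp only [mul_assoc]
  rw [← mul_assoc, h2] at *
  rw [h1, neg_mul, ← intervalIntegral.integral_const_mul]
  simp [mul_assoc]

theorem periodic_deriv {φ : ℝ → ℂ} {p : ℝ} (hp : Function.Periodic φ p) :
    Function.Periodic (deriv φ) p := fun x => by
  rw [← deriv_comp_add_const]
  congr 1
  exact funext hp

theorem pairExp_iteratedDeriv (n : ℕ) {φ : ℝ → ℂ} (hφ : ContDiff ℝ ∞ φ)
    (hp : Function.Periodic φ (2 * Real.pi)) (k : ℤ) :
    pairExp (iteratedDeriv n φ) k = (-(Complex.I * k)) ^ n * pairExp φ k := by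
  induction n generalizing φ with
  | zero => simp
  | succ n ih =>
    rw [iteratedDeriv_succ', ih (contDiff_infty_iff_deriv.1 hφ).2 (periodic_deriv hp),
      pairExp_deriv hφ hp]
    ring

/-- The formal adjoint `-∂⁵ + ∂³ + ∂` of `∂⁵ - ∂³ - ∂`. -/
noncomputable def adjointOp (φ : ℝ → ℂ) (x : ℝ) : ℂ :=
  -iteratedDeriv 5 φ x + iteratedDeriv 3 φ x + deriv φ x

theorem continuous_adjointOp {φ : ℝ → ℂ} (hφ : ContDiff ℝ ∞ φ) : Continuous (adjointOp φ) := by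
  have h5 := (contDiff_infty.1 hφ 5).continuous_iteratedDeriv 5 le_rfl
  have h3 := (contDiff_infty.1 hφ 3).continuous_iteratedDeriv 3 le_rfl
  have h1 : Continuous (deriv φ) := hφ.continuous_deriv (by simp)
  unfold adjointOp
  fun_prop

theorem eig_eq_neg_pow (k : ℤ) : eig k =
    -(-(Complex.I * k)) ^ 5 + (-(Complex.I * k)) ^ 3 + -(Complex.I * k) := by
  rw [eig_spec]; ring

theorem pairExp_adjointOp {φ : ℝ → ℂ} (hφ : ContDiff ℝ ∞ φ)
    (hp : Function.Periodic φ (2 * Real.pi)) (k : ℤ) :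
    pairExp (adjointOp φ) k = eig k * pairExp φ k := by
  have h5 := (contDiff_infty.1 hφ 5).continuous_iteratedDeriv 5 le_rfl
  have h3 := (contDiff_infty.1 hφ 3).continuous_iteratedDeriv 3 le_rfl
  have h1 : Continuous (deriv φ) := hφ.continuous_deriv (by simp)
  have e5 := pairExp_iteratedDeriv 5 hφ hp k
  have e3 := pairExp_iteratedDeriv 3 hφ hp k
  have e1 := pairExp_deriv hφ hp k
  unfold pairExp at *
  simp only [adjointOp, mul_add, mul_neg]
  rw [intervalIntegral.integral_add, intervalIntegral.integral_add, intervalIntegral.integral_neg,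
    e5, e3, e1, eig_eq_neg_pow]
  · ring
  all_goals exact Continuous.intervalIntegrable (by fun_prop) _ _

/-! ### Duhamel coefficients and existence of a weak solution -/

theorem re_eig (n : ℤ) : (eig n).re = 0 := by
  rw [eig, show (n * (n ^ 4 + n ^ 2 - 1) : ℂ) = ((n * (n ^ 4 + n ^ 2 - 1) : ℤ) : ℂ) by push_cast; rfl,
    ← Complex.ofReal_intCast, Complex.I_mul_re, Complex.ofReal_im, neg_zero]

theorem norm_exp_eig_mul (n : ℤ) (t : ℝ) : ‖Complex.exp (eig n * t)‖ = 1 := by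
  rw [Complex.norm_exp, Complex.re_mul_ofReal, re_eig, zero_mul, Real.exp_zero]

theorem norm_exp_neg_eig_mul (n : ℤ) (t : ℝ) : ‖Complex.exp (-eig n * t)‖ = 1 := by
  rw [Complex.norm_exp, Complex.re_mul_ofReal, Complex.neg_re, re_eig, neg_zero, zero_mul,
    Real.exp_zero]

theorem hasDerivAt_exp_mul (c : ℂ) (t : ℝ) :
    HasDerivAt (fun t : ℝ => Complex.exp (c * t)) (c * Complex.exp (c * t)) t := by
  have := ((Complex.ofRealCLM.hasDerivAt (x := t)).const_mul c).cexp
  simpa [mul_comm] using this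

/-- The `k`-th Fourier coefficient of the solution with forcing `f v` and initial value `u₀`. -/
noncomputable def duhamel (f u₀ : L2per) (v : ℝ → ℂ) (k : ℤ) (t : ℝ) : ℂ :=
  Complex.exp (eig k * t) *
    (fcoeff u₀ k + fcoeff f k * ∫ s in (0 : ℝ)..t, Complex.exp (-eig k * s) * v s)

variable {f u₀ : L2per} {v : ℝ → ℂ}

theorem hasDerivAt_duhamel (hv : Continuous v) (k : ℤ) (t : ℝ) :
    HasDerivAt (duhamel f u₀ v k) (eig k * duhamel f u₀ v k t + fcoeff f k * v t) t := by
  have h1 : Continuous fun s : ℝ => Complex.exp (-eig k * s) * v s := by fun_prop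
  have h2 := ((h1.integral_hasStrictDerivAt 0 t).hasDerivAt.const_mul (fcoeff f k)).const_add
    (fcoeff u₀ k)
  have h3 := (hasDerivAt_exp_mul (eig k) t).mul h2
  refine h3.congr_deriv ?_
  have h4 : Complex.exp (eig k * t) * Complex.exp (-eig k * t) = 1 := by
    rw [← Complex.exp_add]; simp
  rw [duhamel]
  linear_combination fcoeff f k * v t * h4

theorem continuous_duhamel (hv : Continuous v) (k : ℤ) : Continuous (duhamel f u₀ v k) :=
  continuous_iff_continuousAt.2 fun t => (hasDerivAt_duhamel hv k t).continuousAt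

theorem duhamel_zero (k : ℤ) : duhamel f u₀ v k 0 = fcoeff u₀ k := by
  simp [duhamel]

theorem duhamel_eq_integral (hv : Continuous v) (k : ℤ) (t : ℝ) :
    duhamel f u₀ v k t = fcoeff u₀ k +
      ∫ s in (0 : ℝ)..t, (eig k * duhamel f u₀ v k s + fcoeff f k * v s) := by
  have hc := continuous_duhamel (f := f) (u₀ := u₀) hv k
  rw [intervalIntegral.integral_eq_sub_of_hasDerivAt (fun s _ => hasDerivAt_duhamel hv k s)
    (Continuous.intervalIntegrable (by fun_prop) _ _), duhamel_zero]
  ring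

/-- Since `λ_k` is imaginary, all exponentials have modulus one. The bound is uniform for `|t| ≤ R`
and square summable in `k`, so it serves as the dominating sequence below. -/
theorem norm_duhamel_le {M : ℝ} (hM : ∀ s, ‖v s‖ ≤ M) (k : ℤ) {t R : ℝ} (ht : |t| ≤ R) :
    ‖duhamel f u₀ v k t‖ ≤ ‖fcoeff u₀ k‖ + ‖fcoeff f k‖ * (M * R) := by
  have hM0 : 0 ≤ M := (norm_nonneg _).trans (hM 0)
  rw [duhamel, norm_mul, norm_exp_eig_mul, one_mul]
  refine (norm_add_le _ _).trans ?_
  rw [norm_mul]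
  gcongr
  refine (intervalIntegral.norm_integral_le_of_norm_le_const (C := M) fun s _ => ?_).trans ?_
  · rw [norm_mul, norm_exp_neg_eig_mul, one_mul]; exact hM s
  · rw [sub_zero]; gcongr

theorem summable_sq_duhamel_bound (f u₀ : L2per) (K : ℝ) :
    Summable fun k => (‖fcoeff u₀ k‖ + ‖fcoeff f k‖ * K) ^ 2 := by
  refine Summable.of_nonneg_of_le (fun _ => by positivity) (fun k => add_sq_le) ?_
  simp only [mul_pow]
  exact ((hasSum_sq_fcoeff u₀).summable.add
    ((hasSum_sq_fcoeff f).summable.mul_right _)).mul_left _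

theorem continuous_of_fcoeff_eq_duhamel (hv : Continuous v) {M : ℝ} (hM : ∀ s, ‖v s‖ ≤ M)
    {u : ℝ → L2per} (hu : ∀ t k, fcoeff (u t) k = duhamel f u₀ v k t) : Continuous u := by
  rw [continuous_iff_continuousAt]
  intro t₀
  have hsum := summable_sq_duhamel_bound f u₀ (M * (|t₀| + 1))
  have key : Tendsto (fun t => ∑' k, ‖duhamel f u₀ v k t - duhamel f u₀ v k t₀‖ ^ 2) (𝓝 t₀)
      (𝓝 (∑' _ : ℤ, (0 : ℝ))) := by
    -- For `|t| ≤ |t₀| + 1` both coefficients obey the same bound, so their difference is at most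
    -- twice it; squaring gives the factor 4.
    refine tendsto_tsum_of_dominated_convergence (hsum.mul_left 4) (fun k => ?_) ?_
    · have hc : Continuous fun t => ‖duhamel f u₀ v k t - duhamel f u₀ v k t₀‖ ^ 2 := by
        have := continuous_duhamel (f := f) (u₀ := u₀) hv k
        fun_prop
      simpa using hc.tendsto t₀
    · have hnear : ∀ᶠ t in 𝓝 t₀, |t| ≤ |t₀| + 1 :=
        (continuous_abs.tendsto t₀).eventually_le_const (by linarith)
      filter_upwards [hnear] with t ht k
      rw [Real.norm_of_nonneg (by positivity)]
      have h1 := norm_duhamel_le (f := f) (u₀ := u₀) hM k ht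
      have h2 := norm_duhamel_le (f := f) (u₀ := u₀) hM k (show |t₀| ≤ |t₀| + 1 by linarith)
      have h3 := norm_sub_le (duhamel f u₀ v k t) (duhamel f u₀ v k t₀)
      calc _ ≤ (2 * (‖fcoeff u₀ k‖ + ‖fcoeff f k‖ * (M * (|t₀| + 1)))) ^ 2 := by
            gcongr; linarith
        _ = _ := by ring
  rw [tsum_zero] at key
  have hnorm : ∀ t, ‖u t - u t₀‖ ^ 2 =
      2 * Real.pi * ∑' k, ‖duhamel f u₀ v k t - duhamel f u₀ v k t₀‖ ^ 2 := fun t => by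
    have h1 := (hasSum_sq_fcoeff (u t - u t₀)).tsum_eq
    simp only [fcoeff_sub, hu] at h1
    rw [h1, mul_inv_cancel_left₀ Real.two_pi_pos.ne']
  rw [ContinuousAt, tendsto_iff_norm_sub_tendsto_zero]
  have h2 : Tendsto (fun t => ‖u t - u t₀‖ ^ 2) (𝓝 t₀) (𝓝 0) := by
    simp only [hnorm]
    simpa using key.const_mul (2 * Real.pi)
  simpa [Real.sqrt_sq (norm_nonneg _)] using h2.sqrt

/-- The Duhamel coefficients are square summable, hence define `u t`. The weak identity is the sum
over `k` of the scalar integral equations times `pairExp φ k`, with sum and time integral exchanged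
by dominated convergence. -/
theorem exists_isWeakSolution (T : ℝ) (f u₀ : L2per) (hv : Continuous v) {M : ℝ}
    (hM : ∀ s, ‖v s‖ ≤ M) : ∃ u : ℝ → L2per, IsWeakSolution T f u₀ v u := by
  have hM0 : 0 ≤ M := (norm_nonneg _).trans (hM 0)
  have hex : ∀ t, ∃ h : L2per, ∀ k, fcoeff h k = duhamel f u₀ v k t := fun t =>
    exists_fcoeff_eq ((summable_sq_duhamel_bound f u₀ (M * |t|)).of_nonneg_of_le
      (fun _ => by positivity) fun k => by
        gcongr
        exact norm_duhamel_le hM k le_rfl)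
  choose u hu using hex
  refine ⟨u, (continuous_of_fcoeff_eq_duhamel hv hM hu).continuousOn, ?_, ?_⟩
  · rw [← sub_eq_zero]
    refine eq_zero_of_fcoeff_eq_zero fun k => ?_
    rw [fcoeff_sub, hu, duhamel_zero, sub_self]
  intro φ hφ hp t ht
  have hψ := continuous_adjointOp hφ
  have hsummable : ∀ {χ : ℝ → ℂ}, Continuous χ → ∀ K : ℝ, 0 ≤ K → Summable fun k =>
      ‖pairExp χ k‖ * (‖fcoeff u₀ k‖ + ‖fcoeff f k‖ * K) := fun {χ} hχ K hK => by
    refine Summable.of_nonneg_of_le (fun _ => by positivity) (fun k => ?_)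
      ((summable_sq_pairExp hχ).add (summable_sq_duhamel_bound f u₀ K))
    nlinarith [sq_nonneg (‖pairExp χ k‖ - (‖fcoeff u₀ k‖ + ‖fcoeff f k‖ * K)),
      sq_nonneg (‖pairExp χ k‖), sq_nonneg (‖fcoeff u₀ k‖ + ‖fcoeff f k‖ * K)]
  have hR := hasSum_fcoeff_mul_pairExp (u t) hφ.continuous
  have h0 := hasSum_fcoeff_mul_pairExp u₀ hφ.continuous
  have hI : HasSum (fun k => ∫ s in (0 : ℝ)..t, (duhamel f u₀ v k s * pairExp (adjointOp φ) k +
      v s * (fcoeff f k * pairExp φ k)))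
      (∫ s in (0 : ℝ)..t, ((∫ x in (0 : ℝ)..(2 * Real.pi), u s x * adjointOp φ x) +
        v s * ∫ x in (0 : ℝ)..(2 * Real.pi), f x * φ x)) := by
    refine intervalIntegral.hasSum_integral_of_dominated_convergence
      -- The term `‖fcoeff u₀ k‖` in the second summand is superfluous; it gives both summands the
      -- shape covered by `hsummable`.
      (fun k _ => ‖pairExp (adjointOp φ) k‖ * (‖fcoeff u₀ k‖ + ‖fcoeff f k‖ * (M * t)) +
        ‖pairExp φ k‖ * (‖fcoeff u₀ k‖ + ‖fcoeff f k‖ * M)) (fun k => ?_) (fun k => ?_)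
        (ae_of_all _ fun s _ => ?_) intervalIntegrable_const (ae_of_all _ fun s _ => ?_)
    · have := continuous_duhamel (f := f) (u₀ := u₀) hv k
      exact Continuous.aestronglyMeasurable (by fun_prop)
    · refine ae_of_all _ fun s hs => ?_
      rw [uIoc_of_le ht.1] at hs
      have hs' : |s| ≤ t := by rw [abs_of_pos hs.1]; exact hs.2
      refine (norm_add_le _ _).trans ?_
      simp only [norm_mul]
      have h1 := norm_duhamel_le (f := f) (u₀ := u₀) hM k hs'
      have h2 := hM s
      refine add_le_add ?_ ?_
      · rw [mul_comm]; gcongr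
      · calc ‖v s‖ * (‖fcoeff f k‖ * ‖pairExp φ k‖) ≤ M * (‖fcoeff f k‖ * ‖pairExp φ k‖) := by
              gcongr
          _ = ‖pairExp φ k‖ * (0 + ‖fcoeff f k‖ * M) := by ring
          _ ≤ _ := by gcongr; positivity
    · exact (hsummable hψ _ (mul_nonneg hM0 ht.1)).add (hsummable hφ.continuous _ hM0)
    · have h1 := hasSum_fcoeff_mul_pairExp (u s) hψ
      simp only [hu] at h1
      exact h1.add ((hasSum_fcoeff_mul_pairExp f hφ.continuous).mul_left (v s))
  refine hR.unique ?_
  refine (h0.add hI).congr_fun fun k => ?_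
  rw [hu, duhamel_eq_integral hv, add_mul, ← intervalIntegral.integral_mul_const]
  congr 1
  refine intervalIntegral.integral_congr fun s _ => ?_
  simp only [pairExp_adjointOp hφ hp]
  ring

/-! ### Fourier coefficients of an arbitrary weak solution -/

theorem iteratedDeriv_exp_mul (c : ℂ) (n : ℕ) (x : ℝ) :
    iteratedDeriv n (fun x : ℝ => Complex.exp (c * x)) x = c ^ n * Complex.exp (c * x) := by
  induction n generalizing x with
  | zero => simp
  | succ n ih =>
    rw [iteratedDeriv_succ, funext ih, ((hasDerivAt_exp_mul c x).const_mul (c ^ n)).deriv]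
    ring

theorem adjointOp_exp (k : ℤ) (x : ℝ) :
    adjointOp (fun x : ℝ => Complex.exp (-(Complex.I * k) * x)) x =
      eig k * Complex.exp (-(Complex.I * k) * x) := by
  rw [adjointOp, iteratedDeriv_exp_mul, iteratedDeriv_exp_mul, (hasDerivAt_exp_mul _ x).deriv,
    eig_eq_neg_pow]
  ring

theorem periodic_exp (k : ℤ) :
    Function.Periodic (fun x : ℝ => Complex.exp (-(Complex.I * k) * x)) (2 * Real.pi) := fun x => by
  have : -(Complex.I * k) * ((x + 2 * Real.pi : ℝ) : ℂ) =
      -(Complex.I * k) * x + (-k : ℤ) * (2 * Real.pi * Complex.I) := by push_cast; ring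
  simp only [this, Complex.exp_add, Complex.exp_int_mul_two_pi_mul_I, mul_one]

theorem integral_mul_exp (h : L2per) (k : ℤ) :
    ∫ x in (0 : ℝ)..(2 * Real.pi), h x * Complex.exp (-(Complex.I * k) * x) =
      2 * Real.pi * fcoeff h k := by
  have h2 : (Real.pi : ℂ) ≠ 0 := by exact_mod_cast Real.pi_ne_zero
  rw [fcoeff_eq]
  simp only [neg_mul]
  field_simp

/-- The test function `e^{-ikx}` is an eigenfunction of the adjoint for the same `λ_k`, so the weak
identity closes on a single coefficient. -/
theorem IsWeakSolution.fcoeff_eq {T : ℝ} {u : ℝ → L2per} (hu : IsWeakSolution T f u₀ v u) (k : ℤ)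
    {t : ℝ} (ht : t ∈ Icc 0 T) :
    fcoeff (u t) k = fcoeff u₀ k +
      ∫ s in (0 : ℝ)..t, (eig k * fcoeff (u s) k + fcoeff f k * v s) := by
  have hpi : (2 * Real.pi : ℂ) ≠ 0 := by exact_mod_cast Real.two_pi_pos.ne'
  have hsm : ContDiff ℝ ∞ fun x : ℝ => Complex.exp (-(Complex.I * k) * x) :=
    (contDiff_const.mul Complex.ofRealCLM.contDiff).cexp
  have h1 := hu.weak _ hsm (periodic_exp k) t ht
  have h2 : ∀ s, (∫ x in (0 : ℝ)..(2 * Real.pi), u s x *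
      adjointOp (fun x : ℝ => Complex.exp (-(Complex.I * k) * x)) x) =
      eig k * (2 * Real.pi * fcoeff (u s) k) := fun s => by
    simp only [adjointOp_exp, ← integral_mul_exp, ← intervalIntegral.integral_const_mul]
    congr 1
    ext x
    ring
  simp only [adjointOp] at h2
  simp only [h2, integral_mul_exp] at h1
  apply mul_left_cancel₀ hpi
  rw [h1, mul_add, ← intervalIntegral.integral_const_mul]
  congr 2
  ext s
  ring

theorem IsWeakSolution.fcoeff_eq_duhamel {T : ℝ} (hT : 0 ≤ T) {u : ℝ → L2per}
    (hu : IsWeakSolution T f u₀ v u) (hv : Continuous v) (k : ℤ) :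
    fcoeff (u T) k = duhamel f u₀ v k T := by
  -- Continuity of `u` is known only on `[0, T]`. Extending by the endpoint values lets `y` be
  -- differentiated at every `t`, endpoints included; the integrating factor `e^{-λ_k t}` then
  -- solves the equation.
  have hw : Continuous fun s => fcoeff (IccExtend hT (fun s : Icc 0 T => u s) s) k :=
    (continuous_fcoeff k).comp (continuousOn_iff_continuous_domRestrict.1 hu.continuousOn).Icc_extend'
  set w := fun s => fcoeff (IccExtend hT (fun s : Icc 0 T => u s) s) k with hw_def
  have hwu : ∀ s ∈ Icc 0 T, w s = fcoeff (u s) k := fun s hs => by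
    simp only [hw_def, IccExtend_of_mem hT _ hs]
  set y : ℝ → ℂ := fun t => fcoeff u₀ k + ∫ s in (0 : ℝ)..t, (eig k * w s + fcoeff f k * v s)
  have hg : Continuous fun s => eig k * w s + fcoeff f k * v s := by fun_prop
  have hy : ∀ t, HasDerivAt y (eig k * w t + fcoeff f k * v t) t := fun t =>
    (hg.integral_hasStrictDerivAt 0 t).hasDerivAt.const_add _
  have hyw : ∀ t ∈ Icc 0 T, y t = w t := fun t ht => by
    rw [hwu t ht, hu.fcoeff_eq k ht]
    simp only [y]
    congr 1
    refine intervalIntegral.integral_congr fun s hs => ?_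
    rw [uIcc_of_le ht.1] at hs
    simp only [hwu s ⟨hs.1, hs.2.trans ht.2⟩]
  have hd : ∀ t ∈ uIcc 0 T, HasDerivAt (fun t : ℝ => Complex.exp (-eig k * t) * y t)
      (fcoeff f k * (Complex.exp (-eig k * t) * v t)) t := fun t ht => by
    rw [uIcc_of_le hT] at ht
    refine ((hasDerivAt_exp_mul (-eig k) t).mul (hy t)).congr_deriv ?_
    rw [hyw t ht]
    ring
  have h1 := intervalIntegral.integral_eq_sub_of_hasDerivAt hd
    (Continuous.intervalIntegrable (by fun_prop) _ _)
  have hT' : T ∈ Icc 0 T := ⟨hT, le_rfl⟩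
  have h0 : y 0 = fcoeff u₀ k := by simp [y]
  rw [intervalIntegral.integral_const_mul, hyw T hT', hwu T hT', h0] at h1
  rw [duhamel, h1]
  have h4 : Complex.exp (eig k * T) * Complex.exp (-eig k * T) = 1 := by
    rw [← Complex.exp_add]; simp
  simp only [Complex.ofReal_zero, mul_zero, Complex.exp_zero]
  linear_combination -fcoeff (u T) k * h4

/-! ### Orthogonality of the exponentials in time -/

/-- The integer frequency `n (n⁴ + n² - 1)`. -/
def freq (n : ℤ) : ℤ := n * (n ^ 4 + n ^ 2 - 1)

theorem eig_eq_freq (n : ℤ) : eig n = Complex.I * (freq n : ℂ) := by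
  rw [eig, freq]; push_cast; rfl

/-- Dividing the difference by `m - n` leaves a quartic form plus `m² + mn + n² - 1`. For distinct
integers the quadratic form is at least 1 and the positive definite quartic form is positive, so the
quotient cannot vanish. -/
theorem freq_injective : Function.Injective freq := by
  intro m n h
  by_contra hne
  have h1 : (m - n) * (m ^ 4 + m ^ 3 * n + m ^ 2 * n ^ 2 + m * n ^ 3 + n ^ 4 +
      (m ^ 2 + m * n + n ^ 2) - 1) = 0 := by
    unfold freq at h
    linear_combination h
  have h2 := (mul_eq_zero.1 h1).resolve_left (sub_ne_zero.2 hne)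
  have h3 : 0 < (m - n) ^ 2 := by have := sub_ne_zero.2 hne; positivity
  have h4 : 1 ≤ m ^ 2 + m * n + n ^ 2 := by nlinarith [sq_nonneg (m + n)]
  have h5 : 0 < m ^ 2 + n ^ 2 := by nlinarith [sq_nonneg (m + n)]
  have h6 : 0 < (m ^ 2 + n ^ 2) ^ 2 := by positivity
  nlinarith [sq_nonneg (m ^ 2 + m * n), sq_nonneg (n ^ 2 + m * n), sq_nonneg (m * n),
    sq_nonneg (m ^ 2 - n ^ 2), sq_nonneg (m + n), sq_nonneg (m * (m + n)),
    sq_nonneg (n * (m + n)), sq_nonneg (2 * m ^ 2 + m * n), sq_nonneg (2 * n ^ 2 + m * n)]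

theorem integral_exp_eig (m n : ℤ) (a : ℝ) :
    ∫ t in a..(a + 4 * Real.pi), Complex.exp (eig m * t) * Complex.exp (-eig n * t) =
      if m = n then (4 * Real.pi : ℂ) else 0 := by
  have h0 := integral_exp_int (freq m - freq n) a 2
  have h1 : ∀ t : ℝ, Complex.exp (eig m * t) * Complex.exp (-eig n * t) =
      Complex.exp (Complex.I * (freq m - freq n : ℤ) * t) := fun t => by
    rw [← Complex.exp_add, eig_eq_freq, eig_eq_freq]; push_cast; ring_nf
  simp only [h1]
  rw [show a + 4 * Real.pi = a + (2 : ℕ) * (2 * Real.pi) by push_cast; ring, h0]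
  simp only [sub_eq_zero, freq_injective.eq_iff]
  split_ifs
  · push_cast; ring
  · rfl

theorem conj_exp_eig (n : ℤ) (t : ℝ) :
    (starRingEnd ℂ) (Complex.exp (eig n * t)) = Complex.exp (-eig n * t) := by
  rw [← Complex.exp_conj, eig_eq_freq]
  simp

/-- Parseval's identity for finite sums of the exponentials `e^{λ_m t}` on an interval of length
`4π`. -/
theorem integral_norm_sq_sum (s : Finset ℤ) (c : ℤ → ℂ) (a : ℝ) :
    ∫ t in a..(a + 4 * Real.pi), ‖∑ m ∈ s, c m * Complex.exp (eig m * t)‖ ^ 2 =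
      4 * Real.pi * ∑ m ∈ s, ‖c m‖ ^ 2 := by
  have h1 : ∀ t : ℝ, ((‖∑ m ∈ s, c m * Complex.exp (eig m * t)‖ ^ 2 : ℝ) : ℂ) =
      ∑ m ∈ s, ∑ n ∈ s, (c m * (starRingEnd ℂ) (c n)) *
        (Complex.exp (eig m * t) * Complex.exp (-eig n * t)) := fun t => by
    rw [Complex.ofReal_pow, ← Complex.mul_conj', map_sum, Finset.sum_mul_sum]
    refine Finset.sum_congr rfl fun m _ => Finset.sum_congr rfl fun n _ => ?_
    rw [map_mul, conj_exp_eig]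
    ring
  apply Complex.ofReal_injective
  rw [← intervalIntegral.integral_ofReal]
  simp only [h1]
  rw [intervalIntegral.integral_finsetSum fun m _ =>
    Continuous.intervalIntegrable (by fun_prop) _ _]
  push_cast
  rw [Finset.mul_sum]
  refine Finset.sum_congr rfl fun m hm => ?_
  rw [intervalIntegral.integral_finsetSum fun m _ =>
    Continuous.intervalIntegrable (by fun_prop) _ _]
  simp only [intervalIntegral.integral_const_mul, integral_exp_eig, mul_ite, mul_zero]
  rw [Finset.sum_ite_eq s m, if_pos hm, Complex.mul_conj']
  ring

/-! ### The control as an absolutely convergent exponential series -/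

/-- The series `∑ d_m e^{λ_m t}`. -/
noncomputable def expSeries (d : ℤ → ℂ) (t : ℝ) : ℂ := ∑' m, d m * Complex.exp (eig m * t)

section expSeries

variable {d : ℤ → ℂ}

theorem norm_mul_exp_eig (d : ℤ → ℂ) (m : ℤ) (t : ℝ) :
    ‖d m * Complex.exp (eig m * t)‖ = ‖d m‖ := by
  rw [norm_mul, norm_exp_eig_mul, mul_one]

theorem summable_mul_exp_eig (hd : Summable fun m => ‖d m‖) (t : ℝ) :
    Summable fun m => d m * Complex.exp (eig m * t) :=
  Summable.of_norm (by simpa only [norm_mul_exp_eig] using hd)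

theorem continuous_expSeries (hd : Summable fun m => ‖d m‖) : Continuous (expSeries d) :=
  continuous_tsum (fun m => by fun_prop) hd fun m t => (norm_mul_exp_eig d m t).le

theorem norm_expSeries_sub_sum_le (hd : Summable fun m => ‖d m‖) (s : Finset ℤ) (t : ℝ) :
    ‖expSeries d t - ∑ m ∈ s, d m * Complex.exp (eig m * t)‖ ≤
      ∑' m : {m // m ∉ s}, ‖d m‖ := by
  rw [expSeries, ← (summable_mul_exp_eig hd t).sum_add_tsum_subtype_compl s, add_sub_cancel_left]
  refine tsum_of_norm_bounded (hd.subtype _).hasSum fun m => (norm_mul_exp_eig d m t).le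

theorem norm_expSeries_le (hd : Summable fun m => ‖d m‖) (t : ℝ) :
    ‖expSeries d t‖ ≤ ∑' m, ‖d m‖ :=
  tsum_of_norm_bounded hd.hasSum fun m => (norm_mul_exp_eig d m t).le

/-- The tail bound is uniform in `t` and the interval has finite measure. The limit along `Finset ℤ`
is what expresses unconditional convergence. -/
theorem tendsto_eLpNorm_expSeries (hd : Summable fun m => ‖d m‖) (T : ℝ) :
    Tendsto (fun s : Finset ℤ => eLpNorm (fun t : ℝ =>
      expSeries d t - ∑ m ∈ s, d m * Complex.exp (eig m * t)) 2 (volume.restrict (Ioc 0 T)))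
      atTop (𝓝 0) := by
  have h1 : Tendsto (fun s : Finset ℤ => (volume.restrict (Ioc 0 T)) univ ^ (2 : ENNReal).toReal⁻¹ *
      ENNReal.ofReal (∑' m : {m // m ∉ s}, ‖d m‖)) atTop (𝓝 0) := by
    have h2 := ENNReal.tendsto_ofReal (tendsto_tsum_compl_atTop_zero fun m => ‖d m‖)
    rw [ENNReal.ofReal_zero] at h2
    simpa using ENNReal.Tendsto.const_mul h2 (Or.inr (ENNReal.rpow_ne_top_of_nonneg
      (by positivity) (measure_ne_top (volume.restrict (Ioc 0 T)) univ)))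
  exact tendsto_of_tendsto_of_tendsto_of_le_of_le tendsto_const_nhds h1 (fun _ => zero_le)
    fun s => eLpNorm_le_of_ae_bound (ae_of_all _ (norm_expSeries_sub_sum_le hd s))

theorem integral_exp_mul_expSeries (hd : Summable fun m => ‖d m‖) (k : ℤ) :
    ∫ t in (0 : ℝ)..(4 * Real.pi), Complex.exp (-eig k * t) * expSeries d t =
      4 * Real.pi * d k := by
  have h1 : HasSum (fun m => ∫ t in (0 : ℝ)..(4 * Real.pi),
      d m * (Complex.exp (eig m * t) * Complex.exp (-eig k * t)))
      (∫ t in (0 : ℝ)..(4 * Real.pi), Complex.exp (-eig k * t) * expSeries d t) := by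
    refine intervalIntegral.hasSum_integral_of_dominated_convergence (fun m _ => ‖d m‖)
      (fun m => Continuous.aestronglyMeasurable (by fun_prop))
      (fun m => ae_of_all _ fun t _ => ?_) (ae_of_all _ fun _ _ => hd) intervalIntegrable_const
      (ae_of_all _ fun t _ => ?_)
    · rw [norm_mul, norm_mul, norm_exp_eig_mul, norm_exp_neg_eig_mul, mul_one, mul_one]
    · refine ((summable_mul_exp_eig hd t).hasSum.mul_left
        (Complex.exp (-eig k * t))).congr_fun fun m => ?_
      ring
  have h2 : ∀ m, ∫ t in (0 : ℝ)..(4 * Real.pi),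
      d m * (Complex.exp (eig m * t) * Complex.exp (-eig k * t)) =
      if m = k then 4 * Real.pi * d k else 0 := fun m => by
    have h3 := integral_exp_eig m k 0
    rw [zero_add] at h3
    rw [intervalIntegral.integral_const_mul, h3]
    split_ifs with h
    · rw [h]; ring
    · rw [mul_zero]
  simp only [h2] at h1
  exact h1.unique (hasSum_ite_eq k _)

end expSeries

/-! ### The weighted norm controls the `ℓ¹` norm -/

theorem summable_exp_neg_pow_six : Summable fun k : ℤ => Real.exp (-(k : ℝ) ^ 6) := by
  have h1 : Summable fun n : ℕ => Real.exp (-(n : ℝ) ^ 6) := by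
    refine Real.summable_exp_neg_nat.of_nonneg_of_le (fun _ => (Real.exp_pos _).le) fun n => ?_
    gcongr
    exact_mod_cast Nat.le_self_pow (by norm_num) n
  refine Summable.of_nat_of_neg (by simpa using h1) ?_
  have h2 : ∀ n : ℕ, (-(n : ℝ)) ^ 6 = (n : ℝ) ^ 6 := fun n => by ring
  simpa [h2] using h1

/-- Cauchy–Schwarz after writing `‖a k‖ = (‖a k‖ e^{k⁶/2}) e^{-k⁶/2}`. -/
theorem summable_norm_and_tsum_le {β : ℝ} (hβ : 1 ≤ β) {f h : L2per} (hh : MemH β f h) :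
    Summable (fun k => ‖fcoeff h k / fcoeff f k‖) ∧
      ∑' k, ‖fcoeff h k / fcoeff f k‖ ≤
        normH β f h * Real.sqrt (∑' k : ℤ, Real.exp (-(k : ℝ) ^ 6)) := by
  set a : ℤ → ℂ := fun k => fcoeff h k / fcoeff f k with ha
  have hh' : Summable fun k : ℤ => ‖a k‖ ^ 2 * Real.exp (β * (k : ℝ) ^ 6) := hh
  have e1 : ∀ k : ℤ, (‖a k‖ * Real.exp ((k : ℝ) ^ 6 / 2)) ^ (2 : ℝ) =
      ‖a k‖ ^ 2 * Real.exp ((k : ℝ) ^ 6) := fun k => by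
    rw [Real.rpow_two, mul_pow, ← Real.exp_nat_mul]
    congr 2
    push_cast; ring
  have e2 : ∀ k : ℤ, Real.exp (-(k : ℝ) ^ 6 / 2) ^ (2 : ℝ) = Real.exp (-(k : ℝ) ^ 6) := fun k => by
    rw [Real.rpow_two, ← Real.exp_nat_mul]
    congr 1
    push_cast; ring
  have e3 : ∀ k : ℤ, ‖a k‖ * Real.exp ((k : ℝ) ^ 6 / 2) * Real.exp (-(k : ℝ) ^ 6 / 2) = ‖a k‖ :=
    fun k => by
      rw [mul_assoc, ← Real.exp_add]
      ring_nf
      simp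
  have hle : ∀ k : ℤ, ‖a k‖ ^ 2 * Real.exp ((k : ℝ) ^ 6) ≤
      ‖a k‖ ^ 2 * Real.exp (β * (k : ℝ) ^ 6) := fun k => by
    gcongr
    have : 0 ≤ (k : ℝ) ^ 6 := by positivity
    nlinarith
  have hs1 : Summable fun k : ℤ => ‖a k‖ ^ 2 * Real.exp ((k : ℝ) ^ 6) :=
    hh'.of_nonneg_of_le (fun _ => by positivity) hle
  have key := Real.summable_and_inner_le_Lp_mul_Lq_tsum_of_nonneg Real.HolderConjugate.two_two
    (f := fun k : ℤ => ‖a k‖ * Real.exp ((k : ℝ) ^ 6 / 2))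
    (g := fun k : ℤ => Real.exp (-(k : ℝ) ^ 6 / 2))
    (fun _ => by positivity) (fun _ => by positivity) (by simpa only [e1] using hs1)
    (by simpa only [e2] using summable_exp_neg_pow_six)
  simp only [e1, e2, e3, ← Real.sqrt_eq_rpow] at key
  refine ⟨key.1, key.2.trans ?_⟩
  rw [normH]
  refine mul_le_mul_of_nonneg_right (Real.sqrt_le_sqrt ?_) (Real.sqrt_nonneg _)
  exact hs1.tsum_le_tsum hle hh'

end Kawahara

/-! ### Null controllability -/

open Kawahara in
theorem theorem2p3 :
    ∃ (T b C : ℝ) (ζ : ℤ → ℝ → ℂ),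
      2 * Real.pi < T ∧ 0 < b ∧ 0 < C ∧
      -- a biorthogonal sequence in `L²(-T/2, T/2)`
      (∀ m, MemLp (ζ m) 2 (volume.restrict (Ioc (-T / 2) (T / 2)))) ∧
      (∀ m n : ℤ, ∫ t in (-T / 2)..(T / 2), ζ m t * Complex.exp (-Kawahara.eig n * t) =
        if m = n then 1 else 0) ∧
      (∀ (s : Finset ℤ) (c : ℤ → ℂ),
        ∫ t in (-T / 2)..(T / 2), ‖∑ m ∈ s, c m * ζ m t‖ ^ 2 ≤
          C * ∑ m ∈ s, ‖c m‖ ^ 2 * Real.exp (b * (m : ℝ) ^ 6)) ∧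
      ∀ β : ℝ, b ≤ β → ∀ f : Kawahara.L2per, (∀ k : ℤ, Kawahara.fcoeff f k ≠ 0) →
        ∀ u₀ : Kawahara.L2per, Kawahara.MemH β f u₀ →
          ∃ v : ℝ → ℂ,
            MemLp v 2 (volume.restrict (Ioc 0 T)) ∧
            -- the series for `v` converges unconditionally in `L²(0, T)`
            Tendsto (fun s : Finset ℤ => eLpNorm (fun t : ℝ =>
                v t - (-∑ m ∈ s, Kawahara.fcoeff u₀ m / Kawahara.fcoeff f m *
                  Complex.exp (T / 2 * Kawahara.eig m) * ζ m (t - T / 2)))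
              2 (volume.restrict (Ioc 0 T))) atTop (𝓝 0) ∧
            eLpNorm v 2 (volume.restrict (Ioc 0 T)) ≤
              ENNReal.ofReal (C * Kawahara.normH β f u₀) ∧
            (∃ u : ℝ → Kawahara.L2per, Kawahara.IsWeakSolution T f u₀ v u) ∧
            (∀ u : ℝ → Kawahara.L2per, Kawahara.IsWeakSolution T f u₀ v u → u T = 0) := by
  have hpi := Real.pi_pos
  have h4 : (0 : ℝ) < 4 * Real.pi := by positivity
  have hpi4 : (4 * Real.pi : ℂ) ≠ 0 := by exact_mod_cast h4.ne'
  set S := Real.sqrt (∑' k : ℤ, Real.exp (-(k : ℝ) ^ 6))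
  have hint : ∀ F : ℝ → ℂ, ∫ t in (-(4 * Real.pi) / 2)..(4 * Real.pi / 2), F t =
      ∫ t in (-(2 * Real.pi))..(-(2 * Real.pi) + 4 * Real.pi), F t := fun F => by
    congr 1 <;> ring
  -- `4π` is the first multiple of `2π` beyond `2π`. In `C`, the summand 1 covers the estimate for
  -- `∑ c_m ζ_m`, because `(4π)⁻¹ ≤ 1`; the other summand is the constant in the bound for `v`:
  -- `√(4π)` from sup norm to `L²`, `(4π)⁻¹` from `d`, `S` from Cauchy–Schwarz.
  refine ⟨4 * Real.pi, 1, 1 + Real.sqrt (4 * Real.pi) * (4 * Real.pi)⁻¹ * S,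
    fun m t => (4 * Real.pi : ℂ)⁻¹ * Complex.exp (eig m * t), by linarith, one_pos, by positivity,
    fun m => memLp_of_continuous (by fun_prop) _ _, fun m n => ?_, fun s c => ?_, ?_⟩
  · rw [hint]
    simp only [mul_assoc, intervalIntegral.integral_const_mul]
    rw [integral_exp_eig]
    split_ifs
    · exact inv_mul_cancel₀ hpi4
    · rw [mul_zero]
  · have h1 : (-(4 * Real.pi) / 2) = -(2 * Real.pi) := by ring
    have h2 : 4 * Real.pi / 2 = -(2 * Real.pi) + 4 * Real.pi := by ring
    have h3 := integral_norm_sq_sum s (fun m => c m * (4 * Real.pi : ℂ)⁻¹) (-(2 * Real.pi))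
    rw [h1, h2]
    simp only [← mul_assoc]
    rw [h3, Finset.mul_sum, Finset.mul_sum]
    refine Finset.sum_le_sum fun m _ => ?_
    have h5 : ‖c m * (4 * Real.pi : ℂ)⁻¹‖ = ‖c m‖ * (4 * Real.pi)⁻¹ := by
      rw [norm_mul, norm_inv, norm_mul, Complex.norm_real, Real.norm_of_nonneg hpi.le]
      simp
    have h6 : 1 ≤ Real.exp (1 * (m : ℝ) ^ 6) := Real.one_le_exp (by positivity)
    have h7 : (4 * Real.pi)⁻¹ ≤ 1 := inv_le_one_of_one_le₀ (by linarith [Real.pi_gt_three])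
    calc 4 * Real.pi * ‖c m * (4 * Real.pi : ℂ)⁻¹‖ ^ 2
        = (4 * Real.pi)⁻¹ * (‖c m‖ ^ 2 * 1) := by rw [h5]; field_simp
      _ ≤ (1 + Real.sqrt (4 * Real.pi) * (4 * Real.pi)⁻¹ * S) *
          (‖c m‖ ^ 2 * Real.exp (1 * (m : ℝ) ^ 6)) := by
        gcongr
        exact h7.trans (le_add_of_nonneg_right (by positivity))
  intro β hβ f hf u₀ hu₀
  obtain ⟨hsum, hle⟩ := summable_norm_and_tsum_le hβ hu₀
  set d : ℤ → ℂ := fun m => -(fcoeff u₀ m / fcoeff f m) * (4 * Real.pi : ℂ)⁻¹ with hd_def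
  have hnd : ∀ m, ‖d m‖ = ‖fcoeff u₀ m / fcoeff f m‖ * (4 * Real.pi)⁻¹ := fun m => by
    rw [hd_def, norm_mul, norm_neg, norm_inv, norm_mul (4 : ℂ), Complex.norm_real,
      Real.norm_of_nonneg hpi.le]
    simp
  have hd : Summable fun m => ‖d m‖ := by
    simp only [hnd]
    exact hsum.mul_right _
  have hcont := continuous_expSeries hd
  have hbound := norm_expSeries_le hd
  refine ⟨expSeries d, memLp_of_continuous hcont _ _, ?_, ?_,
    exists_isWeakSolution _ f u₀ hcont hbound, fun u hu => eq_zero_of_fcoeff_eq_zero fun k => ?_⟩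
  · refine (tendsto_eLpNorm_expSeries hd (4 * Real.pi)).congr fun s => ?_
    congr 1
    ext t
    rw [← Finset.sum_neg_distrib]
    congr 1
    refine Finset.sum_congr rfl fun m _ => ?_
    -- The factor `e^{Tλ_m/2}` exactly undoes the shift of `ζ_m` by `T/2`.
    have : Complex.exp (eig m * t) = Complex.exp (((4 * Real.pi : ℝ) : ℂ) / 2 * eig m) *
        Complex.exp (eig m * ((t - 4 * Real.pi / 2 : ℝ) : ℂ)) := by
      rw [← Complex.exp_add]
      push_cast
      ring_nf
    rw [this, hd_def]
    ring
  · refine (eLpNorm_le_of_ae_bound (ae_of_all _ hbound)).trans ?_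
    have hN : 0 ≤ normH β f u₀ := Real.sqrt_nonneg _
    rw [Measure.restrict_apply_univ, Real.volume_Ioc, sub_zero, ENNReal.toReal_ofNat,
      ENNReal.ofReal_rpow_of_nonneg h4.le (by norm_num), ← one_div, ← Real.sqrt_eq_rpow,
      ← ENNReal.ofReal_mul (Real.sqrt_nonneg _)]
    refine ENNReal.ofReal_le_ofReal ?_
    simp only [hnd, tsum_mul_right]
    calc Real.sqrt (4 * Real.pi) * ((∑' k, ‖fcoeff u₀ k / fcoeff f k‖) * (4 * Real.pi)⁻¹)
        ≤ Real.sqrt (4 * Real.pi) * ((normH β f u₀ * S) * (4 * Real.pi)⁻¹) := by gcongr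
      _ = 0 * normH β f u₀ + Real.sqrt (4 * Real.pi) * (4 * Real.pi)⁻¹ * S * normH β f u₀ := by
        ring
      _ ≤ 1 * normH β f u₀ + Real.sqrt (4 * Real.pi) * (4 * Real.pi)⁻¹ * S * normH β f u₀ := by
        gcongr; exact zero_le_one
      _ = _ := by ring
  -- What remains is `û⁰_k + f̂_k · 4π d_k = 0`, where `f̂_k ≠ 0` is needed to cancel.
  · rw [hu.fcoeff_eq_duhamel h4.le hcont, duhamel, integral_exp_mul_expSeries hd]
    have := hf k
    rw [hd_def]
    field_simp
    ring
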